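/- Let $N$ agents act over the time steps $t\in[T]=\{1,\dots,T\}$. The state spaces $\mathcal X_t$ ($t\in[T+1]$), observation spaces $\mathcal Y^i_t$, action spaces $\mathcal U^i_t$, and noise spaces $\mathcal W^0_t$, $\mathcal W^i_t$ ($i\in[N]$, $t\in[T]$) are Polish spaces with their Borel $\sigma$-algebras. The initial state $X_1$ and the noises $W^{0:N}_{1:T}$ are mutually independent random variables with given distributions. The states and observations are $$X_{t+1}=\tilde f_t(X_{1:t},U^{1:N}_{1:t},W^0_t),\qquad Y^i_t=\tilde h^i_t(X_{1:t},U^{1:N}_{1:t-1},W^i_t),$$ and the cost is $\tilde c(X_{1:T+1},Y^{1:N}_{1:T},U^{1:N}_{1:T})\ge 0$. There is no observation sharing and no recall: the action $U^i_t$ is chosen on the basis of $Y^i_t$ alone. A behavioral strategy of agent $i$ at time $t$ is a stochastic kernel $\pi^i_t(du^i_t\mid y^i_t)$ from $\mathcal Y^i_t$ to $\mathcal U^i_t$ (the agents randomize independently of one another and of everything else); a deterministic strategy is a Borel map $\gamma^i_t:\mathcal Y^i_t\to\mathcal U^i_t$, identified with the kernel $\delta_{\gamma^i_t(y^i_t)}(du^i_t)$.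 Let $J(\pi^{1:N}_{1:T})\in[0,\infty]$ be the expected cost under the joint distribution induced by the behavioral strategies $\pi^{1:N}_{1:T}$. Write $\omega_0=(x_1,w^0_{1:T})\in\Omega_0=\mathcal X_1\times\prod_{t}\mathcal W^0_t$, and let $h^i_t(\omega_0,w^i_t,u^{1:N}_{1:t-1})$ be the observation of agent $i$ at time $t$ obtained by substituting the state equation recursively in $\tilde h^i_t$. Assume: 1. (Continuity) all $\tilde f_t$ and $\tilde h^i_t$ and the cost $\tilde c$ are continuous. 2. (Finite cost) $J(\pi^{1:N}_{1:T})<\infty$ for some behavioral strategies $\pi^{1:N}_{1:T}$. 3. (Absolute continuity) for all $i\in[N]$, $t\in[T]$ there are a Borel probability measure $\nu^i_t$ on $\mathcal Y^i_t$ and a continuous function $\varphi^i_t:\mathcal Y^i_t\times\Omega_0\times\prod_{s<t}\prod_{j}\mathcal U^j_s\to[0,\infty)$ such that for all $\omega_0$, $u^{1:N}_{1:t-1}$ and all Borel sets $S\subset\mathcal Y^i_t$, $$\Pr\{h^i_t(\omega_0,W^i_t,u^{1:N}_{1:t-1})\in S\}=\int_S\varphi^i_t(y;\omega_0,u^{1:N}_{1:t-1})\,\nu^i_t(dy).$$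 4. (Compactness) all action spaces $\mathcal U^i_t$ are compact. Then the team admits an optimal solution in deterministic strategies: there are deterministic strategies $\gamma^{1:N}_{1:T}$ with $J(\gamma^{1:N}_{1:T})=\inf_{\pi^{1:N}_{1:T}}J(\pi^{1:N}_{1:T})$, the infimum being over all behavioral strategies. -/

import Mathlib

open MeasureTheory ProbabilityTheory
open scoped NNReal ENNReal

noncomputable section

namespace Team

/-- The first `k` entries of a finite sequence of elements `a s : A s`, `s : Fin n`. -/
abbrev Hist {n : ℕ} (A : Fin n → Type*) (k : ℕ) := ∀ s : {s : Fin n // (s : ℕ) < k}, A s.1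

/-- Append an entry with index `k` to the first `k` entries of a sequence. -/
def Hist.append {n : ℕ} {A : Fin n → Type*} {k : ℕ} (hk : k < n) (z : Hist A k)
    (a : A ⟨k, hk⟩) : Hist A (k + 1) := fun s =>
  if h : (s.1 : ℕ) < k then z ⟨s.1, h⟩
  else (show (⟨k, hk⟩ : Fin n) = s.1 from Fin.ext (by have := s.2; simp only; omega)) ▸ a

/-- A dynamic team with `N` agents and `T` time steps in state-space form, without observation
sharing. Times are numbered from `0`: agent `i` acts at the times `t : Fin T`, the states are
`x t` for `t : Fin (T + 1)`.  At time `t`, agent `i` observes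
`y t i = h t i (x 0, …, x t) (u 0, …, u (t - 1)) (w t i)`, and then the state becomes
`x (t + 1) = f t (x 0, …, x t) (u 0, …, u t) (w0 t)`. Here `u s` stands for the actions of all
agents at time `s`. The initial state and all the noises are independent. -/
structure DynamicTeam (N T : ℕ) (X : Fin (T + 1) → Type*) (Y U W : Fin T → Fin N → Type*)
    (W0 : Fin T → Type*)
    [∀ t, MeasurableSpace (X t)] [∀ t i, MeasurableSpace (Y t i)]
    [∀ t i, MeasurableSpace (U t i)] [∀ t i, MeasurableSpace (W t i)]
    [∀ t, MeasurableSpace (W0 t)] where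
  /-- the state transition functions -/
  f : ∀ t : Fin T, Hist X (t + 1) → Hist (fun s => ∀ i, U s i) (t + 1) → W0 t → X t.succ
  /-- the observation functions -/
  h : ∀ (t : Fin T) (i : Fin N), Hist X (t + 1) → Hist (fun s => ∀ i, U s i) t → W t i → Y t i
  /-- the non-negative cost of states, observations and actions -/
  cost : (∀ t, X t) → (∀ t i, Y t i) → (∀ t i, U t i) → ℝ≥0
  /-- the distribution of the initial state -/
  ξX : Measure (X 0)
  /-- the distributions of the actuation noises -/
  ξW0 : ∀ t, Measure (W0 t)
  /-- the distributions of the observation noises -/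
  ξW : ∀ t i, Measure (W t i)
  measurable_f : ∀ t : Fin T, Measurable fun p : Hist X (t + 1) ×
    Hist (fun s => ∀ i, U s i) (t + 1) × W0 t => f t p.1 p.2.1 p.2.2
  measurable_h : ∀ (t : Fin T) (i : Fin N), Measurable fun p : Hist X (t + 1) ×
    Hist (fun s => ∀ i, U s i) t × W t i => h t i p.1 p.2.1 p.2.2
  measurable_cost : Measurable fun p : (∀ t, X t) × (∀ t i, Y t i) × (∀ t i, U t i) =>
    cost p.1 p.2.1 p.2.2
  prob_ξX : IsProbabilityMeasure ξX
  prob_ξW0 : ∀ t, IsProbabilityMeasure (ξW0 t)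
  prob_ξW : ∀ t i, IsProbabilityMeasure (ξW t i)

/-- A profile of behavioral strategies: agent `i` at time `t` draws its action from a probability
measure which depends, measurably, on its current observation `y t i` alone. -/
structure BehavioralStrategy {N T : ℕ} (Y U : Fin T → Fin N → Type*)
    [∀ t i, MeasurableSpace (Y t i)] [∀ t i, MeasurableSpace (U t i)] where
  kernel : ∀ t i, Kernel (Y t i) (U t i)
  markov : ∀ t i, IsMarkovKernel (kernel t i)

/-- A profile of deterministic strategies: the action of agent `i` at time `t` is a measurable
function of its current observation `y t i` alone. -/
structure DeterministicStrategy {N T : ℕ} (Y U : Fin T → Fin N → Type*)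
    [∀ t i, MeasurableSpace (Y t i)] [∀ t i, MeasurableSpace (U t i)] where
  map : ∀ t i, Y t i → U t i
  measurable : ∀ t i, Measurable (map t i)

/-- The behavioral strategies `δ_{γ(y)}(du)` induced by deterministic strategies `γ`. -/
def DeterministicStrategy.toBehavioral {N T : ℕ} {Y U : Fin T → Fin N → Type*}
    [∀ t i, MeasurableSpace (Y t i)] [∀ t i, MeasurableSpace (U t i)]
    (γ : DeterministicStrategy Y U) : BehavioralStrategy Y U where
  kernel t i := Kernel.deterministic (γ.map t i) (γ.measurable t i)
  markov _ _ := inferInstance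

/-- The product kernel `y ↦ ⊗ᵢ κᵢ(yᵢ)`. -/
def piKernel {N : ℕ} {A B : Fin N → Type*} [∀ i, MeasurableSpace (A i)]
    [∀ i, MeasurableSpace (B i)] (κ : ∀ i, Kernel (A i) (B i)) (hκ : ∀ i, IsMarkovKernel (κ i)) :
    Kernel (∀ i, A i) (∀ i, B i) where
  toFun y := Measure.pi fun i => κ i (y i)
  measurable' := by
    refine Measurable.measure_of_isPiSystem_of_isProbabilityMeasure generateFrom_pi.symm
      isPiSystem_pi ?_
    rintro _ ⟨s, hs, rfl⟩
    simp only [Measure.pi_pi]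
    exact Finset.measurable_prod _ fun i _ =>
      ((κ i).measurable_coe (hs i (Set.mem_univ i))).comp (measurable_pi_apply i)

namespace DynamicTeam

variable {N T : ℕ} {X : Fin (T + 1) → Type*} {Y U W : Fin T → Fin N → Type*}
  {W0 : Fin T → Type*}

/-- `Ω₀`: the possible values of the initial state and of all the actuation noises. -/
abbrev Omega0 (X : Fin (T + 1) → Type*) (W0 : Fin T → Type*) := X 0 × ∀ t, W0 t

variable [∀ t, MeasurableSpace (X t)] [∀ t i, MeasurableSpace (Y t i)]
  [∀ t i, MeasurableSpace (U t i)] [∀ t i, MeasurableSpace (W t i)]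
  [∀ t, MeasurableSpace (W0 t)] (D : DynamicTeam N T X Y U W W0)

/-- The distribution of the initial state and the actuation noises. -/
def ξ0 : Measure (Omega0 X W0) := D.ξX.prod (Measure.pi D.ξW0)

/-- The state at time `k` as a function of `ω₀` and the actions at times `0, …, k - 1`,
by substituting the state equation recursively. -/
def state (ω : Omega0 X W0) :
    ∀ (k : ℕ) (hk : k < T + 1), Hist (fun s => ∀ i, U s i) k → X ⟨k, hk⟩
  | 0, _, _ => ω.1
  | k + 1, hk, u => D.f ⟨k, Nat.lt_of_succ_lt_succ hk⟩
      (fun s => state ω s.1 s.1.2 fun r => u ⟨r.1, lt_of_lt_of_le r.2 (Nat.le_of_lt s.2)⟩) u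
      (ω.2 ⟨k, Nat.lt_of_succ_lt_succ hk⟩)
  termination_by k => k
  decreasing_by exact s.2

/-- The observation `y t i` as a function of `ω₀`, the observation noise `w t i` and the actions
at times `0, …, t - 1`. -/
def obs (t : Fin T) (i : Fin N) (ω : Omega0 X W0) (w : W t i)
    (u : Hist (fun s => ∀ i, U s i) t) : Y t i :=
  D.h t i (fun s => D.state ω s.1 s.1.2 fun r =>
    u ⟨r.1, lt_of_lt_of_le r.2 (Nat.le_of_lt_succ s.2)⟩) u w

/-- The cost as a function of `ω₀`, the observations and the actions. -/
def reducedCost (ω : Omega0 X W0) (y : ∀ t i, Y t i) (u : ∀ t i, U t i) : ℝ≥0 :=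
  D.cost (fun t => D.state ω t t.2 fun s => u s.1) y u

/-- The distribution of the observations of all agents at time `t`, given `ω₀` and the actions
at times `0, …, t - 1`: the observation noises at time `t` are independent. -/
def obsKernel (t : Fin T) :
    Kernel (Omega0 X W0 × Hist (fun s => ∀ i, U s i) t) (∀ i, Y t i) :=
  (Kernel.id ×ₖ Kernel.const _ (Measure.pi (D.ξW t))).map
    fun p i => D.obs t i p.1.1 (p.2 i) p.1.2

/-- The distribution of the observations and actions of all agents at time `t`, given `ω₀` and
the observations and actions at times `0, …, t - 1`: every agent draws its action from its
behavioral strategy at its current observation, independently of everything else. -/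
def stepKernel (π : BehavioralStrategy Y U) (t : Fin T) :
    Kernel (Omega0 X W0 × Hist (fun s => (∀ i, Y s i) × (∀ i, U s i)) t)
      ((∀ i, Y t i) × (∀ i, U t i)) :=
  ((D.obsKernel t).comap (fun p => (p.1, fun s => (p.2 s).2)) (by fun_prop)) ⊗ₖ
    (piKernel (π.kernel t) (π.markov t)).prodMkLeft _

/-- The joint distribution of `ω₀` and of the observations and actions at times `0, …, k - 1`
induced by the behavioral strategies `π`. -/
def law (π : BehavioralStrategy Y U) : ∀ k : ℕ, k ≤ T →
    Measure (Omega0 X W0 × Hist (fun s => (∀ i, Y s i) × (∀ i, U s i)) k)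
  | 0, _ => D.ξ0.map fun ω => (ω, fun s => absurd s.2 (Nat.not_lt_zero _))
  | k + 1, hk => ((law π k (Nat.le_of_succ_le hk)) ⊗ₘ D.stepKernel π ⟨k, hk⟩).map
      fun p => (p.1.1, Hist.append (A := fun s => (∀ i, Y s i) × (∀ i, U s i)) hk p.1.2 p.2)

/-- The expected cost of behavioral strategies. -/
def J (π : BehavioralStrategy Y U) : ℝ≥0∞ :=
  ∫⁻ p, D.reducedCost p.1 (fun t => (p.2 ⟨t, t.2⟩).1) (fun t => (p.2 ⟨t, t.2⟩).2)
    ∂(D.law π T le_rfl)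

/-- Some behavioral strategies have finite expected cost. -/
def FiniteCost : Prop := ∃ π : BehavioralStrategy Y U, D.J π < ∞

/-- The behavioral strategies `π` are optimal: they attain the infimum of the expected cost over
all behavioral strategies. -/
def IsOptimal (π : BehavioralStrategy Y U) : Prop := D.J π = ⨅ π', D.J π'

section Topology

variable [∀ t, TopologicalSpace (X t)] [∀ t i, TopologicalSpace (Y t i)]
  [∀ t i, TopologicalSpace (U t i)] [∀ t i, TopologicalSpace (W t i)]
  [∀ t, TopologicalSpace (W0 t)]

/-- The state transition functions and the observation functions are continuous. -/
structure ContinuousDynamics : Prop where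
  continuous_f : ∀ t : Fin T, Continuous fun p : Hist X (t + 1) ×
    Hist (fun s => ∀ i, U s i) (t + 1) × W0 t => D.f t p.1 p.2.1 p.2.2
  continuous_h : ∀ (t : Fin T) (i : Fin N), Continuous fun p : Hist X (t + 1) ×
    Hist (fun s => ∀ i, U s i) t × W t i => D.h t i p.1 p.2.1 p.2.2

/-- The cost function is continuous. -/
def ContinuousCost : Prop :=
  Continuous fun p : (∀ t, X t) × (∀ t i, Y t i) × (∀ t i, U t i) => D.cost p.1 p.2.1 p.2.2

/-- For all `t` and `i`, there is a probability measure `ν` on the space of the observations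
`y t i` with respect to which the distribution of `y t i`, given any `ω₀` and any actions at times
`0, …, t - 1`, has a density that is jointly continuous in `y t i`, `ω₀` and these actions. -/
def AbsContObservations : Prop :=
  ∀ (t : Fin T) (i : Fin N), ∃ ν : Measure (Y t i), IsProbabilityMeasure ν ∧
    ∃ φ : Y t i → Omega0 X W0 → Hist (fun s => ∀ i, U s i) t → ℝ≥0,
      (Continuous fun p : Y t i × Omega0 X W0 × Hist (fun s => ∀ i, U s i) t =>
        φ p.1 p.2.1 p.2.2) ∧
      ∀ (ω : Omega0 X W0) (u : Hist (fun s => ∀ i, U s i) t) (S : Set (Y t i)),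
        MeasurableSet S →
        (D.ξW t i).map (fun w => D.obs t i ω w u) S = ∫⁻ y in S, φ y ω u ∂ν

end Topology

end DynamicTeam

end Team

end

/-! The proof is Witsenhausen's static reduction followed by a compactness argument and a
purification. By absolute continuity, the observations may be taken independent with laws `ν t i`,
at the price of putting the product of the densities `φ t i` into the cost (`lintegral_law`,
`J_eq`). An action uses only the current observation of its agent, so after this change of measure
the pairs (observation, action) are independent with laws `ν t i ⊗ₘ π.kernel t i`, and the integrand
is a nonnegative continuous function that does not depend on the strategies.

Existence: the laws `ν ⊗ₘ κ` are exactly the probability measures with first marginal `ν`, a weakly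
compact set since the action space is compact (`isCompact_marginalSet`). Products of measures are
weakly continuous in their factors and integrals of nonnegative continuous functions are weakly
lower semicontinuous, so a minimum is attained; disintegration turns the minimizer into behavioral
strategies (`exists_minimal_behavioral`).

Purification: the cost is affine in each single kernel. For each observation some action costs at
most the average over the kernel, and it can be chosen measurably (`exists_measurable_selection`).
Treating the finitely many pairs `(t, i)` one by one gives deterministic strategies that cost no
more (`exists_deterministic_le`). -/

open MeasureTheory ProbabilityTheory
open scoped NNReal ENNReal
open Filter Topology

noncomputable section

namespace Team

section General

/-! ### Lower semicontinuity of integrals -/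

/-- The truncation of a continuous function with values in `ℝ≥0` at the level `n`. -/
def truncate {E : Type*} [TopologicalSpace E] (f : E → ℝ≥0) (hf : Continuous f) (n : ℕ) :
    BoundedContinuousFunction E ℝ≥0 :=
  BoundedContinuousFunction.mkOfBound ⟨fun x => min (f x) n, by fun_prop⟩ n fun x y => by
    have h1 : ((min (f x) n : ℝ≥0) : ℝ) ≤ n := by exact_mod_cast min_le_right (f x) n
    have h2 : ((min (f y) n : ℝ≥0) : ℝ) ≤ n := by exact_mod_cast min_le_right (f y) n
    have h3 := (min (f x) (n : ℝ≥0)).2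
    have h4 := (min (f y) (n : ℝ≥0)).2
    rw [NNReal.dist_eq]
    exact abs_sub_le_of_nonneg_of_le h3 h1 h4 h2

lemma iSup_min_natCast (a : ℝ≥0) : ⨆ n : ℕ, ((min a n : ℝ≥0) : ℝ≥0∞) = a := by
  refine le_antisymm (iSup_le fun n => ENNReal.coe_le_coe.2 (min_le_left _ _)) ?_
  obtain ⟨n, hn⟩ := exists_nat_ge a
  exact le_iSup_of_le n (by rw [min_eq_left hn])

lemma lintegral_eq_iSup_truncate {E : Type*} [MeasurableSpace E] {f : E → ℝ≥0}
    (hf : Measurable f) (μ : Measure E) :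
    ∫⁻ x, f x ∂μ = ⨆ n : ℕ, ∫⁻ x, (min (f x) n : ℝ≥0) ∂μ := by
  rw [← lintegral_iSup (fun n => by fun_prop)]
  · simp only [iSup_min_natCast]
  · intro m n hmn x
    exact ENNReal.coe_le_coe.2 (min_le_min_left _ (by exact_mod_cast hmn))

/-- The integral is the supremum of those of the truncations `min f n`, which are bounded and
continuous and hence have weakly continuous integrals. -/
lemma lowerSemicontinuous_lintegral_probabilityMeasure {E : Type*} [TopologicalSpace E]
    [MeasurableSpace E] [OpensMeasurableSpace E] {f : E → ℝ≥0} (hf : Continuous f) :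
    LowerSemicontinuous fun μ : ProbabilityMeasure E => ∫⁻ x, f x ∂(μ : Measure E) := by
  simp only [lintegral_eq_iSup_truncate hf.measurable]
  refine lowerSemicontinuous_iSup fun n => Continuous.lowerSemicontinuous ?_
  refine continuous_iff_continuousAt.2 fun μ => ?_
  exact ProbabilityMeasure.tendsto_iff_forall_lintegral_tendsto.1 tendsto_id (truncate f hf n)

/-- The same truncation, with dominated convergence for each level; first countability makes the
neighborhood filters countably generated, as dominated convergence requires. -/
lemma lowerSemicontinuous_lintegral_parameter {E Z : Type*} [TopologicalSpace E]
    [FirstCountableTopology E] [TopologicalSpace Z] [MeasurableSpace Z] [OpensMeasurableSpace Z]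
    (μ : Measure Z) [IsFiniteMeasure μ] {f : E → Z → ℝ≥0}
    (hf : Continuous (Function.uncurry f)) :
    LowerSemicontinuous fun x => ∫⁻ z, f x z ∂μ := by
  have hx (x : E) : Continuous (f x) := hf.comp (by fun_prop : Continuous fun z => (x, z))
  have hz (z : Z) : Continuous fun x => f x z := hf.comp (by fun_prop : Continuous fun x => (x, z))
  simp only [fun x => lintegral_eq_iSup_truncate (hx x).measurable μ]
  refine lowerSemicontinuous_iSup fun n => Continuous.lowerSemicontinuous ?_
  refine continuous_iff_continuousAt.2 fun x => ?_
  refine tendsto_lintegral_filter_of_dominated_convergence (fun _ => (n : ℝ≥0∞)) ?_ ?_ ?_ ?_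
  · exact Eventually.of_forall fun y =>
      (((hx y).min continuous_const).measurable).coe_nnreal_ennreal
  · refine Eventually.of_forall fun y => Eventually.of_forall fun z => ?_
    exact_mod_cast min_le_right (f y z) (n : ℝ≥0)
  · rw [lintegral_const]
    exact ENNReal.mul_ne_top (by simp) (measure_ne_top _ _)
  · refine Eventually.of_forall fun z => ?_
    exact (ENNReal.continuous_coe.comp ((hz z).min continuous_const)).continuousAt

/-! ### Measurable selection -/

/-- The Cantor space is ordered by its embedding `e` in the real line, and `γ a` is the least point
of the compact set of those `c` with `g (a, c) ≤ m a`. Being least, it lies below `r` exactly when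
that set meets `{e ≤ r}`, which is a comparison of two measurable functions of `a`. -/
lemma exists_measurable_selection_of_nat_bool {A : Type*} [TopologicalSpace A]
    [MeasurableSpace A] [OpensMeasurableSpace A]
    {g : A × (ℕ → Bool) → ℝ≥0∞} (hg : LowerSemicontinuous g) {m : A → ℝ≥0∞} (hm : Measurable m)
    (h : ∀ a, ∃ c, g (a, c) ≤ m a) :
    ∃ γ : A → (ℕ → Bool), Measurable γ ∧ ∀ a, g (a, γ a) ≤ m a := by
  let e : (ℕ → Bool) → ℝ := fun c => (cantorSetHomeomorphNatToBool.symm c : ℝ)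
  have he : Continuous e := by fun_prop
  have hinj : Function.Injective e :=
    Subtype.val_injective.comp cantorSetHomeomorphNatToBool.symm.injective
  have hga (a : A) : LowerSemicontinuous fun c => g (a, c) :=
    hg.comp (by fun_prop : Continuous fun c : ℕ → Bool => (a, c))
  have hmin (a : A) : ∃ c, g (a, c) ≤ m a ∧ ∀ c', g (a, c') ≤ m a → e c ≤ e c' := by
    obtain ⟨c, hc, hmin⟩ := ((hga a).isClosed_preimage (m a)).isCompact.exists_isMinOn (h a)
      he.continuousOn
    exact ⟨c, hc, fun c' hc' => hmin hc'⟩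
  choose γ hγ hγmin using hmin
  refine ⟨γ, ?_, hγ⟩
  refine (he.isClosedEmbedding hinj).measurableEmbedding.measurable_comp_iff.1 (measurable_of_Iic fun r => ?_)
  have hC : IsCompact {c | e c ≤ r} := (isClosed_le he continuous_const).isCompact
  let v : A → ℝ≥0∞ := fun a => ⨅ c ∈ {c | e c ≤ r}, g (a, c)
  have hatt (hne : {c | e c ≤ r}.Nonempty) (a : A) (b : ℝ≥0∞) :
      v a ≤ b ↔ ∃ c, e c ≤ r ∧ g (a, c) ≤ b := by
    constructor
    · intro hv
      obtain ⟨c, hc, hmin⟩ := ((hga a).lowerSemicontinuousOn _).exists_isMinOn hne hC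
      exact ⟨c, hc, (le_iInf₂ fun c' hc' => hmin hc').trans hv⟩
    · rintro ⟨c, hc, hcb⟩
      exact (iInf₂_le c hc).trans hcb
  by_cases hne : {c | e c ≤ r}.Nonempty
  · have hv : Measurable v := by
      refine measurable_of_Iic fun b => ?_
      -- The infimum is attained, so a sublevel set of `v` is the projection of a closed set along a
      -- compact factor, and is closed.
      have : v ⁻¹' Set.Iic b = Prod.fst '' ({p : A × (ℕ → Bool) | e p.2 ≤ r} ∩ g ⁻¹' Set.Iic b) := by
        ext a
        simp only [Set.mem_preimage, Set.mem_Iic, hatt hne a b]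
        simp
      rw [this]
      exact (isClosedMap_fst_of_compactSpace _ ((isClosed_le (by fun_prop) continuous_const).inter
        (hg.isClosed_preimage b))).measurableSet
    have : e ∘ γ ⁻¹' Set.Iic r = {a | v a ≤ m a} := by
      ext a
      simp only [Set.mem_preimage, Set.mem_Iic, Set.mem_ofPred_eq, hatt hne a _,
        Function.comp]
      exact ⟨fun h => ⟨γ a, h, hγ a⟩, fun ⟨c, hc, hcm⟩ => (hγmin a c hcm).trans hc⟩
    rw [this]
    exact measurableSet_le hv hm
  · have : e ∘ γ ⁻¹' Set.Iic r = ∅ := by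
      ext a
      simp only [Set.mem_preimage, Set.mem_Iic, Function.comp, Set.mem_empty_iff_false, iff_false]
      exact fun h => hne ⟨γ a, h⟩
    rw [this]
    exact .empty

/-- A compact metrizable `B` is a continuous image of the Cantor space, so a selection upstairs can
be pushed down. -/
lemma exists_measurable_selection {A B : Type*} [TopologicalSpace A]
    [MeasurableSpace A] [OpensMeasurableSpace A] [TopologicalSpace B] [PolishSpace B]
    [CompactSpace B] [MeasurableSpace B] [BorelSpace B]
    {g : A × B → ℝ≥0∞} (hg : LowerSemicontinuous g) {m : A → ℝ≥0∞} (hm : Measurable m)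
    (h : ∀ a, ∃ b, g (a, b) ≤ m a) :
    ∃ γ : A → B, Measurable γ ∧ ∀ a, g (a, γ a) ≤ m a := by
  rcases isEmpty_or_nonempty B with hB | hB
  -- The Cantor space maps onto `B` only if `B` is nonempty; if `B` is empty, then so is `A`, by
  -- `h`.
  · have : IsEmpty A := ⟨fun a => hB.elim (h a).choose⟩
    exact ⟨fun a => isEmptyElim a, measurable_of_empty _, fun a => isEmptyElim a⟩
  let := TopologicalSpace.upgradeIsCompletelyMetrizable B
  obtain ⟨p, hp, hsurj⟩ := exists_nat_bool_continuous_surjective_of_compact B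
  obtain ⟨γ, hγ, hγm⟩ := exists_measurable_selection_of_nat_bool
    (g := fun q => g (q.1, p q.2)) (hg.comp (by fun_prop)) hm fun a => by
      obtain ⟨b, hb⟩ := h a
      obtain ⟨c, rfl⟩ := hsurj b
      exact ⟨c, hb⟩
  exact ⟨p ∘ γ, hp.measurable.comp hγ, hγm⟩

/-! ### Finite products of probability measures -/

section Pi

variable {ι : Type*} [Fintype ι] {A B : ι → Type*} [∀ i, MeasurableSpace (A i)]
  [∀ i, MeasurableSpace (B i)]

lemma lintegral_pi_prod (μ : ∀ i, Measure (A i)) [∀ i, IsProbabilityMeasure (μ i)]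
    {f : ∀ i, A i → ℝ≥0∞} (hf : ∀ i, Measurable (f i)) :
    ∫⁻ x, ∏ i, f i (x i) ∂(Measure.pi μ) = ∏ i, ∫⁻ x, f i x ∂(μ i) := by
  have h := lintegral_prod_eq_prod_lintegral_of_indepFun (μ := Measure.pi μ) Finset.univ
    (fun i (x : ∀ i, A i) => f i (x i))
    (iIndepFun_pi fun i => (hf i).aemeasurable) (fun i => by fun_prop)
  rw [h]
  refine Finset.prod_congr rfl fun i _ => ?_
  exact (measurePreserving_eval μ i).lintegral_comp (hf i)

lemma pi_map_update [DecidableEq ι] (μ : ∀ i, Measure (A i)) [∀ i, IsProbabilityMeasure (μ i)]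
    (k : ι) (ρ : Measure (A k)) [IsProbabilityMeasure ρ] :
    ((Measure.pi μ).prod ρ).map (fun p => Function.update p.1 k p.2) =
      Measure.pi (Function.update μ k ρ) := by
  have hprob (i : ι) : IsProbabilityMeasure (Function.update μ k ρ i) := by
    rcases eq_or_ne i k with rfl | hi
    · simpa
    · simp only [Function.update_of_ne hi]; infer_instance
  refine (Measure.pi_eq fun s hs => ?_).symm
  have hmeas : Measurable fun p : (∀ i, A i) × A k => Function.update p.1 k p.2 :=
    measurable_update'
  rw [Measure.map_apply hmeas (.univ_pi hs)]
  have : (fun p : (∀ i, A i) × A k => Function.update p.1 k p.2) ⁻¹' (Set.univ.pi s) =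
      (Set.univ.pi (Function.update s k Set.univ)) ×ˢ s k := by
    ext ⟨x, a⟩
    simp only [Set.mem_preimage, Set.mem_pi, Set.mem_univ, true_implies, Set.mem_prod]
    constructor
    · intro h
      refine ⟨fun i => ?_, by simpa using h k⟩
      rcases eq_or_ne i k with rfl | hi
      · simp
      · simpa [hi] using h i
    · rintro ⟨h, ha⟩ i
      rcases eq_or_ne i k with rfl | hi
      · simpa
      · simpa [hi] using h i
  rw [this, Measure.prod_prod, Measure.pi_pi, ← Finset.prod_erase_mul _ _ (Finset.mem_univ k),
    ← Finset.prod_erase_mul Finset.univ (fun i => Function.update μ k ρ i (s i))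
      (Finset.mem_univ k)]
  simp only [Function.update_self, measure_univ, mul_one]
  congr 1
  refine Finset.prod_congr rfl fun i hi => ?_
  simp [Finset.ne_of_mem_erase hi]

/-- Serves to replace one factor of a product law. With `ρ = μ k` it also isolates one coordinate
without splitting the product type. -/
lemma lintegral_pi_update [DecidableEq ι] (μ : ∀ i, Measure (A i))
    [∀ i, IsProbabilityMeasure (μ i)] (k : ι) (ρ : Measure (A k)) [IsProbabilityMeasure ρ]
    {f : (∀ i, A i) → ℝ≥0∞} (hf : Measurable f) :
    ∫⁻ x, f x ∂(Measure.pi (Function.update μ k ρ)) =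
      ∫⁻ x, ∫⁻ a, f (Function.update x k a) ∂ρ ∂(Measure.pi μ) := by
  have hmeas : Measurable fun p : (∀ i, A i) × A k => Function.update p.1 k p.2 :=
    measurable_update'
  rw [← pi_map_update, lintegral_map hf hmeas]
  exact lintegral_prod _ (hf.comp hmeas).aemeasurable

lemma pi_withDensity (ν : ∀ i, Measure (A i)) [∀ i, IsProbabilityMeasure (ν i)]
    {f : ∀ i, A i → ℝ≥0∞} (hf : ∀ i, Measurable (f i))
    [∀ i, IsProbabilityMeasure ((ν i).withDensity (f i))] :
    Measure.pi (fun i => (ν i).withDensity (f i)) =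
      (Measure.pi ν).withDensity fun x => ∏ i, f i (x i) := by
  refine Measure.pi_eq fun s hs => ?_
  rw [withDensity_apply _ (.univ_pi hs), ← lintegral_indicator (.univ_pi hs)]
  have (x : ∀ i, A i) : (Set.univ.pi s).indicator (fun x => ∏ i, f i (x i)) x =
      ∏ i, (s i).indicator (f i) (x i) := by
    by_cases hx : x ∈ Set.univ.pi s
    · rw [Set.indicator_of_mem hx]
      exact Finset.prod_congr rfl fun i _ => (Set.indicator_of_mem (hx i trivial) _).symm
    · rw [Set.indicator_of_notMem hx]
      simp only [Set.mem_pi, Set.mem_univ, true_implies, not_forall] at hx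
      obtain ⟨i, hi⟩ := hx
      exact (Finset.prod_eq_zero (Finset.mem_univ i) (Set.indicator_of_notMem hi _)).symm
  simp only [this]
  rw [lintegral_pi_prod ν fun i => (hf i).indicator (hs i)]
  exact Finset.prod_congr rfl fun i _ => by
    rw [lintegral_indicator (hs i), withDensity_apply _ (hs i)]

end Pi

/-- Regroups the observations and actions of one time by agent. On boxes both sides are products of
integrals over the single agents. -/
lemma compProd_piKernel {N : ℕ} {A B : Fin N → Type*} [∀ i, MeasurableSpace (A i)]
    [∀ i, MeasurableSpace (B i)] (ν : ∀ i, Measure (A i)) [∀ i, IsProbabilityMeasure (ν i)]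
    (κ : ∀ i, Kernel (A i) (B i)) (hκ : ∀ i, IsMarkovKernel (κ i)) :
    (Measure.pi ν ⊗ₘ piKernel κ hκ).map (fun p i => (p.1 i, p.2 i)) =
      Measure.pi fun i => ν i ⊗ₘ κ i := by
  have : IsMarkovKernel (piKernel κ hκ) :=
    ⟨fun y => inferInstanceAs (IsProbabilityMeasure (Measure.pi fun i => κ i (y i)))⟩
  refine (Measure.pi_eq fun s hs => ?_).symm
  have hmeas : Measurable fun (p : (∀ i, A i) × (∀ i, B i)) i => (p.1 i, p.2 i) := by fun_prop
  rw [Measure.map_apply hmeas (.univ_pi hs), Measure.compProd_apply (hmeas (.univ_pi hs))]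
  have (y : ∀ i, A i) : piKernel κ hκ y (Prod.mk y ⁻¹' ((fun (p : (∀ i, A i) × (∀ i, B i)) i =>
      (p.1 i, p.2 i)) ⁻¹' Set.univ.pi s)) = ∏ i, κ i (y i) (Prod.mk (y i) ⁻¹' s i) := by
    have hset : Prod.mk y ⁻¹' ((fun (p : (∀ i, A i) × (∀ i, B i)) i =>
      (p.1 i, p.2 i)) ⁻¹' Set.univ.pi s) = Set.univ.pi fun i => Prod.mk (y i) ⁻¹' s i := by
      ext u
      simp
    rw [hset]
    exact Measure.pi_pi _ _
  simp only [this]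
  rw [lintegral_pi_prod ν fun i => Kernel.measurable_kernel_prodMk_left (hs i)]
  exact Finset.prod_congr rfl fun i _ => (Measure.compProd_apply (hs i)).symm

/-! ### Compactness of the measures with a given marginal -/

/-- The probability measures on `A × B` with marginal `ν` on `A`. -/
def marginalSet {A : Type*} (B : Type*) [MeasurableSpace A] [MeasurableSpace B] (ν : Measure A) :
    Set (ProbabilityMeasure (A × B)) := {μ | (μ : Measure (A × B)).fst = ν}

/-- Prokhorov: the single measure `ν` is tight on a Polish space, and with `B` compact this makes
the joint laws tight. The marginal condition is closed, as taking marginals is weakly continuous. -/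
lemma isCompact_marginalSet {A B : Type*} [TopologicalSpace A] [PolishSpace A]
    [MeasurableSpace A] [BorelSpace A] [TopologicalSpace B] [PolishSpace B] [CompactSpace B]
    [MeasurableSpace B] [BorelSpace B] (ν : Measure A) [IsProbabilityMeasure ν] :
    IsCompact (marginalSet B ν) := by
  let := TopologicalSpace.upgradeIsCompletelyMetrizable A
  let := TopologicalSpace.upgradeIsCompletelyMetrizable B
  have hclosed : IsClosed (marginalSet B ν) := by
    let ν' : ProbabilityMeasure A := ⟨ν, inferInstance⟩
    have : marginalSet B ν = (fun μ : ProbabilityMeasure (A × B) =>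
        μ.map (measurable_fst (α := A) (β := B)).aemeasurable) ⁻¹' {ν'} := by
      ext μ
      simp only [marginalSet, Set.mem_ofPred_eq, Set.mem_preimage, Set.mem_singleton_iff]
      exact ⟨fun h => Subtype.ext h, fun h => congrArg Subtype.val h⟩
    rw [this]
    exact isClosed_singleton.preimage (ProbabilityMeasure.continuous_map continuous_fst)
  rw [← hclosed.closure_eq]
  refine isCompact_closure_of_isTightMeasureSet (IsTightMeasureSet.prodMk ?_ .of_compactSpace)
  refine (isTightMeasureSet_singleton (μ := ν)).subset ?_
  rintro _ ⟨_, ⟨μ, hμ, rfl⟩, rfl⟩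
  exact hμ

end General

/-- Replace the behavioral strategy of agent `i` at time `t`. -/
def BehavioralStrategy.update {N T : ℕ} {Y U : Fin T → Fin N → Type*}
    [∀ t i, MeasurableSpace (Y t i)] [∀ t i, MeasurableSpace (U t i)]
    (π : BehavioralStrategy Y U) (t : Fin T) (i : Fin N) (κ : Kernel (Y t i) (U t i))
    [IsMarkovKernel κ] : BehavioralStrategy Y U where
  kernel := Function.update π.kernel t (Function.update (π.kernel t) i κ)
  markov s j := by
    rcases eq_or_ne s t with rfl | hs
    · rcases eq_or_ne j i with rfl | hj
      · simpa
      · simpa [hj] using π.markov s j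
    · simpa [hs] using π.markov s j

/-! ### Continuity and measurability of the model -/

namespace DynamicTeam

set_option linter.unusedSectionVars false

variable {N T : ℕ} {X : Fin (T + 1) → Type*} {Y U W : Fin T → Fin N → Type*}
  {W0 : Fin T → Type*}
  [∀ t, TopologicalSpace (X t)] [∀ t, PolishSpace (X t)]
  [∀ t, MeasurableSpace (X t)] [∀ t, BorelSpace (X t)]
  [∀ t i, TopologicalSpace (Y t i)] [∀ t i, PolishSpace (Y t i)]
  [∀ t i, MeasurableSpace (Y t i)] [∀ t i, BorelSpace (Y t i)]
  [∀ t i, TopologicalSpace (U t i)] [∀ t i, PolishSpace (U t i)]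
  [∀ t i, MeasurableSpace (U t i)] [∀ t i, BorelSpace (U t i)]
  [∀ t i, TopologicalSpace (W t i)] [∀ t i, PolishSpace (W t i)]
  [∀ t i, MeasurableSpace (W t i)] [∀ t i, BorelSpace (W t i)]
  [∀ t, TopologicalSpace (W0 t)] [∀ t, PolishSpace (W0 t)]
  [∀ t, MeasurableSpace (W0 t)] [∀ t, BorelSpace (W0 t)]
  {D : DynamicTeam N T X Y U W W0}

/-- Strong induction, since the transition function uses all earlier states. -/
lemma ContinuousDynamics.continuous_state (hdyn : D.ContinuousDynamics) (k : ℕ) (hk : k < T + 1) :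
    Continuous fun p : Omega0 X W0 × Hist (fun s => ∀ i, U s i) k => D.state p.1 k hk p.2 := by
  induction k using Nat.strong_induction_on with
  | _ k ih =>
    cases k with
    | zero =>
      simp only [state]
      fun_prop
    | succ k =>
      simp only [state]
      refine (hdyn.continuous_f ⟨k, Nat.lt_of_succ_lt_succ hk⟩).comp
        (Continuous.prodMk ?_ (by fun_prop :
          Continuous fun p : Omega0 X W0 × Hist (fun s => ∀ i, U s i) (k + 1) =>
            (p.2, p.1.2 ⟨k, Nat.lt_of_succ_lt_succ hk⟩)))
      refine continuous_pi fun s => ?_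
      exact (ih s.1 s.2 s.1.2).comp (by fun_prop :
        Continuous fun p : Omega0 X W0 × Hist (fun s => ∀ i, U s i) (k + 1) =>
          (p.1, fun r : {r : Fin T // (r : ℕ) < s.1} =>
            p.2 ⟨r.1, lt_of_lt_of_le r.2 (Nat.le_of_lt s.2)⟩))

lemma ContinuousDynamics.continuous_obs (hdyn : D.ContinuousDynamics) (t : Fin T) (i : Fin N) :
    Continuous fun p : Omega0 X W0 × W t i × Hist (fun s => ∀ i, U s i) t =>
      D.obs t i p.1 p.2.1 p.2.2 := by
  simp only [obs]
  refine (hdyn.continuous_h t i).comp (Continuous.prodMk ?_ (by fun_prop :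
    Continuous fun p : Omega0 X W0 × W t i × Hist (fun s => ∀ i, U s i) t => (p.2.2, p.2.1)))
  refine continuous_pi fun s => ?_
  exact (hdyn.continuous_state s.1 s.1.2).comp (by fun_prop :
    Continuous fun p : Omega0 X W0 × W t i × Hist (fun s => ∀ i, U s i) t =>
      (p.1, fun r : {r : Fin T // (r : ℕ) < s.1} =>
        p.2.2 ⟨r.1, lt_of_lt_of_le r.2 (Nat.le_of_lt_succ s.2)⟩))

lemma ContinuousDynamics.continuous_reducedCost (hdyn : D.ContinuousDynamics)
    (hcost : D.ContinuousCost) :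
    Continuous fun p : Omega0 X W0 × (∀ t i, Y t i) × (∀ t i, U t i) =>
      D.reducedCost p.1 p.2.1 p.2.2 := by
  simp only [reducedCost]
  refine Continuous.comp hcost (Continuous.prodMk ?_ (by fun_prop))
  refine continuous_pi fun s => ?_
  exact (hdyn.continuous_state s s.2).comp (by fun_prop :
    Continuous fun p : Omega0 X W0 × (∀ t i, Y t i) × (∀ t i, U t i) =>
      (p.1, fun r : {r : Fin T // (r : ℕ) < s} => p.2.2 r.1))

instance instIsProbabilityMeasureξ0 : IsProbabilityMeasure D.ξ0 := by
  have := D.prob_ξX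
  have := D.prob_ξW0
  unfold ξ0
  infer_instance

instance instIsMarkovKernelPiKernel {A B : Fin N → Type*} [∀ i, MeasurableSpace (A i)]
    [∀ i, MeasurableSpace (B i)] (κ : ∀ i, Kernel (A i) (B i)) (hκ : ∀ i, IsMarkovKernel (κ i)) :
    IsMarkovKernel (piKernel κ hκ) :=
  ⟨fun y => inferInstanceAs (IsProbabilityMeasure (Measure.pi fun i => κ i (y i)))⟩

lemma ContinuousDynamics.measurable_obsMap (hdyn : D.ContinuousDynamics) (t : Fin T) :
    Measurable fun (p : (Omega0 X W0 × Hist (fun s => ∀ i, U s i) t) × (∀ i, W t i)) i =>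
      D.obs t i p.1.1 (p.2 i) p.1.2 :=
  measurable_pi_lambda _ fun i => ((hdyn.continuous_obs t i).comp (by fun_prop :
    Continuous fun p : (Omega0 X W0 × Hist (fun s => ∀ i, U s i) t) × (∀ i, W t i) =>
      (p.1.1, p.2 i, p.1.2))).measurable

lemma ContinuousDynamics.isMarkovKernel_obsKernel (hdyn : D.ContinuousDynamics) (t : Fin T) :
    IsMarkovKernel (D.obsKernel t) := by
  have := D.prob_ξW
  exact Kernel.IsMarkovKernel.map _ (hdyn.measurable_obsMap t)

lemma ContinuousDynamics.isMarkovKernel_stepKernel (hdyn : D.ContinuousDynamics)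
    (π : BehavioralStrategy Y U) (t : Fin T) : IsMarkovKernel (D.stepKernel π t) := by
  have := hdyn.isMarkovKernel_obsKernel t
  unfold stepKernel
  infer_instance

lemma measurable_append {A : Fin T → Type*} [∀ t, MeasurableSpace (A t)] {k : ℕ} (hk : k < T) :
    Measurable fun p : Hist A k × A ⟨k, hk⟩ => Hist.append hk p.1 p.2 := by
  refine measurable_pi_lambda _ fun s => ?_
  obtain ⟨⟨s, hsT⟩, hs⟩ := s
  rcases Nat.lt_succ_iff_lt_or_eq.1 hs with h | rfl
  · simp only [Hist.append, h, dif_pos]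
    fun_prop
  -- With the index identified with `k`, the cast in `Hist.append` is the identity.
  · simp only [Hist.append, lt_irrefl, dif_neg, not_false_eq_true]
    fun_prop

lemma measurable_appendMap {B : Type*} [MeasurableSpace B] {A : Fin T → Type*}
    [∀ t, MeasurableSpace (A t)] {k : ℕ} (hk : k < T) :
    Measurable fun p : (B × Hist A k) × A ⟨k, hk⟩ => (p.1.1, Hist.append hk p.1.2 p.2) :=
  (measurable_fst.comp measurable_fst).prodMk ((measurable_append hk).comp
    ((measurable_snd.comp measurable_fst).prodMk measurable_snd))

/-- Lets histories of every length be restrictions of full sequences, so that one static law serves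
all times. -/
lemma append_restrict {A : Fin T → Type*} {k : ℕ} (hk : k < T) (z : ∀ t, A t) (a : A ⟨k, hk⟩) :
    Hist.append (A := A) hk (fun s => z s.1) a =
      fun s : {s : Fin T // (s : ℕ) < k + 1} => Function.update z ⟨k, hk⟩ a s.1 := by
  funext s
  obtain ⟨⟨s, hsT⟩, hs⟩ := s
  rcases Nat.lt_succ_iff_lt_or_eq.1 hs with h | rfl
  · have : (⟨s, hsT⟩ : Fin T) ≠ ⟨k, hk⟩ := fun e => h.ne (congrArg Fin.val e)
    simp only [Hist.append, h, dif_pos, Function.update_of_ne this]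
  · simp [Hist.append]

lemma ContinuousDynamics.isProbabilityMeasure_law (hdyn : D.ContinuousDynamics)
    (π : BehavioralStrategy Y U) (k : ℕ) (hk : k ≤ T) : IsProbabilityMeasure (D.law π k hk) := by
  induction k with
  | zero =>
    unfold law
    exact Measure.isProbabilityMeasure_map (by fun_prop)
  | succ k ih =>
    have := ih (Nat.le_of_succ_le hk)
    have := hdyn.isMarkovKernel_stepKernel π ⟨k, hk⟩
    unfold law
    refine Measure.isProbabilityMeasure_map (Measurable.aemeasurable ?_)
    exact measurable_appendMap hk

/-! ### Static reduction by change of measure -/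

/-- A family of densities `φ t i` of the observations `y t i`, with respect to the probability
measures `ν t i`, given `ω₀` and the actions before time `t`. -/
structure IsObsDensity (D : DynamicTeam N T X Y U W W0) (ν : ∀ t i, Measure (Y t i))
    (φ : ∀ t i, Y t i → Omega0 X W0 → Hist (fun s => ∀ i, U s i) t → ℝ≥0) : Prop where
  prob : ∀ t i, IsProbabilityMeasure (ν t i)
  continuous : ∀ t i, Continuous fun p : Y t i × Omega0 X W0 × Hist (fun s => ∀ i, U s i) t =>
    φ t i p.1 p.2.1 p.2.2
  map_obs : ∀ t i ω u, (D.ξW t i).map (fun w => D.obs t i ω w u) =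
    (ν t i).withDensity fun y => φ t i y ω u

lemma AbsContObservations.exists_isObsDensity (habs : D.AbsContObservations) :
    ∃ ν φ, IsObsDensity D ν φ := by
  choose ν hν φ hφ h using habs
  refine ⟨ν, φ, hν, hφ, fun t i ω u => Measure.ext fun S hS => ?_⟩
  rw [h t i ω u S hS, withDensity_apply _ hS]

/-- The measure on the observations and actions under which the observations `y t i` are
independent with distributions `ν t i`. -/
def staticLaw (ν : ∀ t i, Measure (Y t i)) (π : BehavioralStrategy Y U) :
    Measure (∀ t i, Y t i × U t i) :=
  Measure.pi fun t => Measure.pi fun i => ν t i ⊗ₘ π.kernel t i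

/-- The density of the observations and actions before time `k` with respect to the static
law. -/
def density (φ : ∀ t i, Y t i → Omega0 X W0 → Hist (fun s => ∀ i, U s i) t → ℝ≥0) (k : ℕ)
    (ω : Omega0 X W0) (z : ∀ t i, Y t i × U t i) : ℝ≥0 :=
  ∏ t with (t : Fin T).1 < k, ∏ i, φ t i (z t i).1 ω fun s j => (z s.1 j).2

namespace IsObsDensity

variable {ν : ∀ t i, Measure (Y t i)}
  {φ : ∀ t i, Y t i → Omega0 X W0 → Hist (fun s => ∀ i, U s i) t → ℝ≥0}

lemma continuous_density (hφ : IsObsDensity D ν φ) (k : ℕ) :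
    Continuous fun p : Omega0 X W0 × (∀ t i, Y t i × U t i) => density φ k p.1 p.2 := by
  unfold density
  refine continuous_finsetProd _ fun t _ => continuous_finsetProd _ fun i _ => ?_
  exact (hφ.continuous t i).comp (by fun_prop :
    Continuous fun p : Omega0 X W0 × (∀ t i, Y t i × U t i) =>
      ((p.2 t i).1, p.1, fun (s : {s : Fin T // (s : ℕ) < t}) j => (p.2 s.1 j).2))

/-- The factors at times before `k` do not see the entry at `k`; the factor at `k` sees only its
observations and earlier actions. -/
lemma density_succ_update {k : ℕ} (hk : k < T) (ω : Omega0 X W0) (z : ∀ t i, Y t i × U t i)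
    (a : ∀ i, Y ⟨k, hk⟩ i × U ⟨k, hk⟩ i) :
    density φ (k + 1) ω (Function.update z ⟨k, hk⟩ a) =
      density φ k ω z * ∏ i, φ ⟨k, hk⟩ i (a i).1 ω fun s j => (z s.1 j).2 := by
  have hne (s : Fin T) (h : s.1 < k) : s ≠ ⟨k, hk⟩ := fun e => h.ne (congrArg Fin.val e)
  have hset : Finset.univ.filter (fun t : Fin T => t.1 < k + 1) =
      insert ⟨k, hk⟩ (Finset.univ.filter fun t : Fin T => t.1 < k) := by
    ext t
    simp only [Finset.mem_filter, Finset.mem_univ, true_and, Finset.mem_insert, Fin.ext_iff]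
    omega
  unfold density
  rw [hset, Finset.prod_insert (by simp), mul_comm]
  congr 1
  · refine Finset.prod_congr rfl fun t ht => Finset.prod_congr rfl fun i _ => ?_
    have ht : t.1 < k := by simpa using ht
    rw [Function.update_of_ne (hne t ht)]
    congr 1
    funext s j
    rw [Function.update_of_ne (hne s.1 (s.2.trans ht))]
  · refine Finset.prod_congr rfl fun i _ => ?_
    rw [Function.update_self]
    congr 1
    funext s j
    rw [Function.update_of_ne (hne s.1 s.2)]

/-- Given `ω₀` and the past actions, the observations at time `t` depend on separate independent
noises, so their densities multiply. -/
lemma obsKernel_apply (hφ : IsObsDensity D ν φ) (hdyn : D.ContinuousDynamics) (t : Fin T)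
    (ω : Omega0 X W0) (u : Hist (fun s => ∀ i, U s i) t) :
    D.obsKernel t (ω, u) =
      (Measure.pi (ν t)).withDensity fun y => ∏ i, (φ t i (y i) ω u : ℝ≥0∞) := by
  have := hφ.prob
  have := D.prob_ξW
  have hobs (i : Fin N) : Measurable fun w => D.obs t i ω w u :=
    ((hdyn.continuous_obs t i).comp (by fun_prop : Continuous fun w => (ω, w, u))).measurable
  have hprob (i : Fin N) : IsProbabilityMeasure ((ν t i).withDensity fun y => φ t i y ω u) := by
    rw [← hφ.map_obs]
    exact Measure.isProbabilityMeasure_map (hobs i).aemeasurable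
  have hprob' (i : Fin N) :
      IsProbabilityMeasure ((D.ξW t i).map fun w => D.obs t i ω w u) :=
    Measure.isProbabilityMeasure_map (hobs i).aemeasurable
  rw [← pi_withDensity (ν t) (f := fun i y => φ t i y ω u) fun i =>
    ((hφ.continuous t i).comp (by fun_prop : Continuous fun y => (y, ω, u))).measurable.coe_nnreal_ennreal]
  simp only [← hφ.map_obs]
  rw [← Measure.pi_map_pi fun i => (hobs i).aemeasurable]
  unfold obsKernel
  rw [Kernel.map_apply _ (hdyn.measurable_obsMap t), Kernel.prod_apply, Kernel.id_apply,
    Kernel.const_apply, Measure.dirac_prod,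
    Measure.map_map (hdyn.measurable_obsMap t) (by fun_prop)]
  rfl

lemma lintegral_stepKernel (hφ : IsObsDensity D ν φ) (hdyn : D.ContinuousDynamics)
    (π : BehavioralStrategy Y U) (t : Fin T) (ω : Omega0 X W0)
    (h : Hist (fun s => (∀ i, Y s i) × (∀ i, U s i)) t)
    {F : (∀ i, Y t i) × (∀ i, U t i) → ℝ≥0∞} (hF : Measurable F) :
    ∫⁻ p, F p ∂(D.stepKernel π t (ω, h)) =
      ∫⁻ z, (∏ i, (φ t i (z i).1 ω fun s => (h s).2 : ℝ≥0∞)) *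
        F (fun i => (z i).1, fun i => (z i).2)
        ∂(Measure.pi fun i => ν t i ⊗ₘ π.kernel t i) := by
  have := hφ.prob
  have := π.markov t
  have := hdyn.isMarkovKernel_obsKernel t
  have hφm : Measurable fun y : ∀ i, Y t i =>
      ∏ i, (φ t i (y i) ω fun s => (h s).2 : ℝ≥0∞) :=
    Finset.measurable_prod _ fun i _ => ((hφ.continuous t i).comp (by fun_prop :
      Continuous fun y : ∀ i, Y t i => (y i, ω, fun s => (h s).2))).measurable.coe_nnreal_ennreal
  have hG : Measurable fun p : (∀ i, Y t i) × (∀ i, U t i) =>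
      (∏ i, (φ t i (p.1 i) ω fun s => (h s).2 : ℝ≥0∞)) * F p :=
    (hφm.comp measurable_fst).mul hF
  rw [← compProd_piKernel (ν t) (π.kernel t) (π.markov t)]
  have hGz : Measurable fun z : ∀ i, Y t i × U t i =>
      (∏ i, (φ t i (z i).1 ω fun s => (h s).2 : ℝ≥0∞)) *
        F (fun i => (z i).1, fun i => (z i).2) :=
    hG.comp (by fun_prop :
      Measurable fun z : ∀ i, Y t i × U t i => (fun i => (z i).1, fun i => (z i).2))
  rw [lintegral_map hGz (by fun_prop)]
  dsimp only
  rw [Measure.lintegral_compProd hG]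
  unfold stepKernel
  have hI : Measurable fun y : ∀ i, Y t i =>
      ∫⁻ u, F (y, u) ∂(piKernel (π.kernel t) (π.markov t) y) :=
    Measurable.lintegral_kernel_prod_right hF
  rw [Kernel.lintegral_compProd _ _ _ hF, Kernel.comap_apply, hφ.obsKernel_apply hdyn]
  simp only [Kernel.prodMkLeft_apply]
  rw [lintegral_withDensity_eq_lintegral_mul _ hφm hI]
  refine lintegral_congr fun y => ?_
  simp only [Pi.mul_apply]
  exact (lintegral_const_mul _ (hF.comp measurable_prodMk_left)).symm

/-- Induction on `k`: each step multiplies the density by the factor of the new observations. The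
entries of `z` from time `k` on occur neither in `density φ k` nor in `F`, and integrate out. -/
lemma lintegral_law (hφ : IsObsDensity D ν φ) (hdyn : D.ContinuousDynamics)
    (π : BehavioralStrategy Y U) (k : ℕ) (hk : k ≤ T)
    {F : Omega0 X W0 × Hist (fun s => (∀ i, Y s i) × (∀ i, U s i)) k → ℝ≥0∞}
    (hF : Measurable F) :
    ∫⁻ p, F p ∂(D.law π k hk) =
      ∫⁻ ω, ∫⁻ z, density φ k ω z *
        F (ω, fun s => (fun i => (z s.1 i).1, fun i => (z s.1 i).2)) ∂(staticLaw ν π) ∂D.ξ0 := by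
  have := hφ.prob
  have := fun t i => π.markov t i
  have hstatic : IsProbabilityMeasure (staticLaw ν π) := by unfold staticLaw; infer_instance
  induction k with
  | zero =>
    unfold law
    rw [lintegral_map hF (by fun_prop)]
    refine lintegral_congr fun ω => ?_
    have (z : ∀ t i, Y t i × U t i) : (density φ 0 ω z : ℝ≥0∞) *
        F (ω, fun s => (fun i => (z s.1 i).1, fun i => (z s.1 i).2)) =
        F (ω, fun s => absurd s.2 (Nat.not_lt_zero _)) := by
      have h1 : density φ 0 ω z = 1 := by simp [density]
      rw [h1, ENNReal.coe_one, one_mul]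
      congr 2
      funext s
      exact absurd s.2 (Nat.not_lt_zero _)
    simp only [this, lintegral_const, measure_univ, mul_one]
  | succ k ih =>
    have := hdyn.isMarkovKernel_stepKernel π ⟨k, hk⟩
    have := hdyn.isProbabilityMeasure_law π k (Nat.le_of_succ_le hk)
    have hm : Measurable fun p : (Omega0 X W0 × Hist (fun s => (∀ i, Y s i) × (∀ i, U s i)) k) ×
        (∀ i, Y ⟨k, hk⟩ i) × (∀ i, U ⟨k, hk⟩ i) =>
        (p.1.1, Hist.append (A := fun s => (∀ i, Y s i) × (∀ i, U s i)) hk p.1.2 p.2) :=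
      measurable_appendMap hk
    have hFm : Measurable fun p : (Omega0 X W0 ×
          Hist (fun s => (∀ i, Y s i) × (∀ i, U s i)) k) ×
        (∀ i, Y ⟨k, hk⟩ i) × (∀ i, U ⟨k, hk⟩ i) =>
        F (p.1.1, Hist.append (A := fun s => (∀ i, Y s i) × (∀ i, U s i)) hk p.1.2 p.2) :=
      hF.comp hm
    unfold law
    rw [lintegral_map hF hm, Measure.lintegral_compProd hFm,
      ih _ (Measurable.lintegral_kernel_prod_right hFm)]
    refine lintegral_congr fun ω => ?_
    have hr : Measurable fun z : ∀ t i, Y t i × U t i =>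
        (density φ (k + 1) ω z : ℝ≥0∞) *
        F (ω, fun s => (fun i => (z s.1 i).1, fun i => (z s.1 i).2)) := by
      refine Measurable.mul ?_ (hF.comp (by fun_prop))
      exact ((hφ.continuous_density (k + 1)).comp
        (by fun_prop : Continuous fun z => (ω, z))).measurable.coe_nnreal_ennreal
    -- Resampling the entry at time `k` from its own factor leaves the static law unchanged.
    have hu := lintegral_pi_update
      (fun t => Measure.pi fun i => ν t i ⊗ₘ π.kernel t i) ⟨k, hk⟩
      (Measure.pi fun i => ν ⟨k, hk⟩ i ⊗ₘ π.kernel ⟨k, hk⟩ i) hr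
    rw [Function.update_eq_self] at hu
    refine Eq.trans ?_ hu.symm
    refine lintegral_congr fun z => ?_
    have hs := hφ.lintegral_stepKernel hdyn π ⟨k, hk⟩ ω
      (fun s => (fun i => (z s.1 i).1, fun i => (z s.1 i).2))
      (hFm.comp (measurable_prodMk_left (x :=
        (ω, fun s : {s : Fin T // (s : ℕ) < k} => (fun i => (z s.1 i).1, fun i => (z s.1 i).2)))))
    refine (congrArg (_ * ·) hs).trans ?_
    dsimp only
    rw [← lintegral_const_mul']
    · refine lintegral_congr fun a => ?_
      rw [density_succ_update, ENNReal.coe_mul, ENNReal.ofNNReal_finsetProd, mul_assoc]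
      refine congrArg (_ * ·) (congrArg (_ * ·) (congrArg F (Prod.ext rfl ?_)))
      have := append_restrict (A := fun s => (∀ i, Y s i) × (∀ i, U s i)) hk
        (fun s => (fun i => (z s i).1, fun i => (z s i).2))
        (fun i => (a i).1, fun i => (a i).2)
      refine this.trans (funext fun s => ?_)
      exact (Function.apply_update (fun s (w : ∀ i, Y s i × U s i) =>
        ((fun i => (w i).1, fun i => (w i).2) : (∀ i, Y s i) × (∀ i, U s i)))
        z ⟨k, hk⟩ a s.1).symm
    · exact ENNReal.coe_ne_top

/-- The density of the joint distribution with respect to the static law, times the cost. -/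
def staticCost (D : DynamicTeam N T X Y U W W0)
    (φ : ∀ t i, Y t i → Omega0 X W0 → Hist (fun s => ∀ i, U s i) t → ℝ≥0)
    (ω : Omega0 X W0) (z : ∀ t i, Y t i × U t i) : ℝ≥0 :=
  density φ T ω z * D.reducedCost ω (fun t i => (z t i).1) fun t i => (z t i).2

lemma continuous_staticCost (hφ : IsObsDensity D ν φ) (hdyn : D.ContinuousDynamics)
    (hcost : D.ContinuousCost) :
    Continuous fun p : Omega0 X W0 × (∀ t i, Y t i × U t i) => staticCost D φ p.1 p.2 := by
  refine (hφ.continuous_density T).mul ?_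
  exact (hdyn.continuous_reducedCost hcost).comp (by fun_prop :
    Continuous fun p : Omega0 X W0 × (∀ t i, Y t i × U t i) =>
      (p.1, (fun t i => (p.2 t i).1), fun t i => (p.2 t i).2))

/-- The strategies now enter through the product law alone. -/
lemma J_eq (hφ : IsObsDensity D ν φ) (hdyn : D.ContinuousDynamics) (hcost : D.ContinuousCost)
    (π : BehavioralStrategy Y U) :
    D.J π = ∫⁻ p, staticCost D φ p.1 p.2 ∂(D.ξ0.prod (staticLaw ν π)) := by
  have := hφ.prob
  have := fun t i => π.markov t i
  have hstatic : IsProbabilityMeasure (staticLaw ν π) := by unfold staticLaw; infer_instance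
  unfold J
  rw [hφ.lintegral_law hdyn π T le_rfl]
  · rw [lintegral_prod _
      (hφ.continuous_staticCost hdyn hcost).measurable.coe_nnreal_ennreal.aemeasurable]
    simp only [staticCost, ENNReal.coe_mul]
  · exact ((hdyn.continuous_reducedCost hcost).measurable.comp (by fun_prop :
      Measurable fun p : Omega0 X W0 × Hist (fun s => (∀ i, Y s i) × (∀ i, U s i)) T =>
        (p.1, (fun t i => (p.2 ⟨t, t.2⟩).1 i), fun t i => (p.2 ⟨t, t.2⟩).2 i))).coe_nnreal_ennreal

/-! ### Replacing the strategy of one agent at one time -/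

lemma staticLaw_update (π : BehavioralStrategy Y U) (t : Fin T) (i : Fin N)
    (κ : Kernel (Y t i) (U t i)) [IsMarkovKernel κ] :
    staticLaw ν (π.update t i κ) =
      Measure.pi (Function.update (fun s => Measure.pi fun j => ν s j ⊗ₘ π.kernel s j) t
        (Measure.pi (Function.update (fun j => ν t j ⊗ₘ π.kernel t j) i (ν t i ⊗ₘ κ)))) := by
  unfold staticLaw
  congr 1
  funext s
  rcases eq_or_ne s t with rfl | hs
  · rw [Function.update_self]
    congr 1
    funext j
    rcases eq_or_ne j i with rfl | hj
    · simp [BehavioralStrategy.update]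
    · simp [BehavioralStrategy.update, hj]
  · simp [BehavioralStrategy.update, hs]

/-- The expected cost when agent `i` observes `a.1` and acts `a.2` at time `t`, under the static
law of the other observations and actions. -/
def coordinateCost (D : DynamicTeam N T X Y U W W0) (ν : ∀ t i, Measure (Y t i))
    (φ : ∀ t i, Y t i → Omega0 X W0 → Hist (fun s => ∀ i, U s i) t → ℝ≥0)
    (π : BehavioralStrategy Y U) (t : Fin T) (i : Fin N) (a : Y t i × U t i) : ℝ≥0∞ :=
  ∫⁻ q, staticCost D φ q.1 (Function.update q.2.1 t (Function.update q.2.2 i a))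
    ∂(D.ξ0.prod ((staticLaw ν π).prod (Measure.pi fun j => ν t j ⊗ₘ π.kernel t j)))

lemma continuous_staticCost_update (hφ : IsObsDensity D ν φ) (hdyn : D.ContinuousDynamics)
    (hcost : D.ContinuousCost) (t : Fin T) (i : Fin N) :
    Continuous fun p : (Y t i × U t i) × Omega0 X W0 × (∀ t i, Y t i × U t i) ×
      (∀ i, Y t i × U t i) =>
      staticCost D φ p.2.1 (Function.update p.2.2.1 t (Function.update p.2.2.2 i p.1)) :=
  (hφ.continuous_staticCost hdyn hcost).comp
    (Continuous.prodMk (by fun_prop) (Continuous.update (by fun_prop) t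
      (Continuous.update (by fun_prop) i (by fun_prop))))

lemma lowerSemicontinuous_coordinateCost (hφ : IsObsDensity D ν φ) (hdyn : D.ContinuousDynamics)
    (hcost : D.ContinuousCost) (π : BehavioralStrategy Y U) (t : Fin T) (i : Fin N) :
    LowerSemicontinuous (coordinateCost D ν φ π t i) := by
  have := hφ.prob
  have := fun t i => π.markov t i
  have hstatic : IsProbabilityMeasure (staticLaw ν π) := by unfold staticLaw; infer_instance
  exact lowerSemicontinuous_lintegral_parameter _
    (hφ.continuous_staticCost_update hdyn hcost t i)

/-- The static law is a product, so the kernel `κ` enters through one factor only. `coordinateCost`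
overwrites the entry `(t, i)` and hence does not depend on the kernel that `κ` replaces. -/
lemma J_update (hφ : IsObsDensity D ν φ) (hdyn : D.ContinuousDynamics)
    (hcost : D.ContinuousCost) (π : BehavioralStrategy Y U) (t : Fin T) (i : Fin N)
    (κ : Kernel (Y t i) (U t i)) [IsMarkovKernel κ] :
    D.J (π.update t i κ) =
      ∫⁻ y, ∫⁻ u, coordinateCost D ν φ π t i (y, u) ∂(κ y) ∂(ν t i) := by
  have := hφ.prob
  have := fun t i => π.markov t i
  have hstatic : IsProbabilityMeasure (staticLaw ν π) := by unfold staticLaw; infer_instance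
  have hstatic' : IsProbabilityMeasure (staticLaw ν (π.update t i κ)) := by
    have := fun s j => (π.update t i κ).markov s j
    unfold staticLaw
    infer_instance
  have hc := hφ.continuous_staticCost hdyn hcost
  have hcu := hφ.continuous_staticCost_update hdyn hcost t i
  have hI := hcu.measurable.coe_nnreal_ennreal.lintegral_prod_left' (μ := ν t i ⊗ₘ κ)
  have hprob (j : Fin N) : IsProbabilityMeasure
      (Function.update (fun j => ν t j ⊗ₘ π.kernel t j) i (ν t i ⊗ₘ κ) j) := by
    rcases eq_or_ne j i with rfl | hj
    · simp only [Function.update_self]; infer_instance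
    · simp only [Function.update_of_ne hj]; infer_instance
  rw [hφ.J_eq hdyn hcost,
    ← Measure.lintegral_compProd (hφ.lowerSemicontinuous_coordinateCost hdyn hcost π t i).measurable]
  unfold coordinateCost
  rw [lintegral_lintegral_swap hcu.measurable.coe_nnreal_ennreal.aemeasurable,
    lintegral_prod _ hc.measurable.coe_nnreal_ennreal.aemeasurable,
    lintegral_prod _ hI.aemeasurable]
  refine lintegral_congr fun ω => ?_
  have hcω : Measurable fun z => (staticCost D φ ω z : ℝ≥0∞) :=
    (hc.comp (by fun_prop : Continuous fun z => (ω, z))).measurable.coe_nnreal_ennreal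
  -- Two nested products need two updates: first the whole row at time `t`, then the entry `i` in a
  -- fresh row.
  rw [staticLaw_update, lintegral_pi_update _ _ _ hcω, lintegral_prod]
  · refine lintegral_congr fun z => ?_
    exact lintegral_pi_update _ _ _ (hcω.comp (measurable_update z))
  · exact (hI.comp measurable_prodMk_left).aemeasurable

lemma update_self (π : BehavioralStrategy Y U) (t : Fin T) (i : Fin N) :
    (have := π.markov t i; π.update t i (π.kernel t i)) = π := by
  simp [BehavioralStrategy.update]

lemma exists_deterministic_update (hφ : IsObsDensity D ν φ) (hU : ∀ t i, CompactSpace (U t i))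
    (hdyn : D.ContinuousDynamics) (hcost : D.ContinuousCost) (π : BehavioralStrategy Y U)
    (t : Fin T) (i : Fin N) :
    ∃ (γ : Y t i → U t i) (hγ : Measurable γ),
      D.J (π.update t i (Kernel.deterministic γ hγ)) ≤ D.J π := by
  have := π.markov t i
  have hg := hφ.lowerSemicontinuous_coordinateCost hdyn hcost π t i
  obtain ⟨γ, hγ, hle⟩ := exists_measurable_selection hg
    (m := fun y => ∫⁻ u, coordinateCost D ν φ π t i (y, u) ∂(π.kernel t i y))
    (Measurable.lintegral_kernel_prod_right hg.measurable)
    -- Under a probability measure a function is somewhere at most its mean.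
    fun y => exists_le_lintegral (hg.measurable.comp measurable_prodMk_left).aemeasurable
  refine ⟨γ, hγ, ?_⟩
  have hπ := hφ.J_update hdyn hcost π t i (π.kernel t i)
  rw [update_self] at hπ
  rw [hπ, hφ.J_update hdyn hcost]
  refine lintegral_mono fun y => ?_
  have hgy : Measurable fun u => coordinateCost D ν φ π t i (y, u) :=
    hg.measurable.comp measurable_prodMk_left
  rw [Kernel.lintegral_deterministic' hγ hgy]
  exact hle y

/-- Each replacement keeps the kernels that are already deterministic and does not raise the cost.
-/
lemma exists_deterministic_le (hφ : IsObsDensity D ν φ) (hU : ∀ t i, CompactSpace (U t i))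
    (hdyn : D.ContinuousDynamics) (hcost : D.ContinuousCost) (π : BehavioralStrategy Y U) :
    ∃ γ : DeterministicStrategy Y U, D.J γ.toBehavioral ≤ D.J π := by
  have key (S : Finset (Fin T × Fin N)) : ∃ π' : BehavioralStrategy Y U, D.J π' ≤ D.J π ∧
      ∀ p ∈ S, ∃ (γ : Y p.1 p.2 → U p.1 p.2) (hγ : Measurable γ),
        π'.kernel p.1 p.2 = Kernel.deterministic γ hγ := by
    induction S using Finset.induction_on with
    | empty => exact ⟨π, le_rfl, by simp⟩
    | insert p S _ ih =>
      obtain ⟨π', hle, hdet⟩ := ih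
      obtain ⟨γ, hγ, hle'⟩ := hφ.exists_deterministic_update hU hdyn hcost π' p.1 p.2
      refine ⟨_, hle'.trans hle, fun q hq => ?_⟩
      by_cases hqp : q = p
      · subst hqp
        exact ⟨γ, hγ, by simp [BehavioralStrategy.update]⟩
      · obtain ⟨γ', hγ', h⟩ := hdet q ((Finset.mem_insert.1 hq).resolve_left hqp)
        refine ⟨γ', hγ', ?_⟩
        obtain ⟨s, j⟩ := q
        obtain ⟨t, i⟩ := p
        rw [← h]
        rcases eq_or_ne s t with rfl | hs
        · have hj : j ≠ i := fun e => hqp (by rw [e])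
          simp [BehavioralStrategy.update, hj]
        · simp [BehavioralStrategy.update, hs]
  obtain ⟨⟨κ, hκ⟩, hle, hdet⟩ := key Finset.univ
  choose γ hγ h using fun t i => hdet (t, i) (Finset.mem_univ _)
  obtain rfl : κ = fun t i => Kernel.deterministic (γ t i) (hγ t i) :=
    funext fun t => funext fun i => h t i
  exact ⟨⟨γ, hγ⟩, hle⟩

/-! ### Existence of optimal behavioral strategies -/

lemma exists_minimal_behavioral (hφ : IsObsDensity D ν φ) (hU : ∀ t i, CompactSpace (U t i))
    (hdyn : D.ContinuousDynamics) (hcost : D.ContinuousCost) (π₀ : BehavioralStrategy Y U) :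
    ∃ π : BehavioralStrategy Y U, ∀ π', D.J π ≤ D.J π' := by
  have := hφ.prob
  let ξ : ProbabilityMeasure (Omega0 X W0) := ⟨D.ξ0, inferInstance⟩
  let K : Set (∀ t i, ProbabilityMeasure (Y t i × U t i)) :=
    Set.univ.pi fun t => Set.univ.pi fun i => marginalSet (U t i) (ν t i)
  let Φ : (∀ t i, ProbabilityMeasure (Y t i × U t i)) → ProbabilityMeasure
      (Omega0 X W0 × (∀ t i, Y t i × U t i)) := fun μ =>
    ξ.prod (ProbabilityMeasure.pi fun t => ProbabilityMeasure.pi fun i => μ t i)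
  -- Weak limits are taken in each factor separately, so the joint limit stays a product and
  -- independence survives.
  have hΦ : Continuous Φ := by
    refine ProbabilityMeasure.continuous_prod.comp (continuous_const.prodMk ?_)
    refine ProbabilityMeasure.continuous_pi.comp (continuous_pi fun t => ?_)
    exact ProbabilityMeasure.continuous_pi.comp (continuous_apply t)
  let toLaw : BehavioralStrategy Y U → ∀ t i, ProbabilityMeasure (Y t i × U t i) := fun π t i =>
    ⟨ν t i ⊗ₘ π.kernel t i, by have := π.markov t i; infer_instance⟩
  have hK : IsCompact K := isCompact_univ_pi fun t => isCompact_univ_pi fun i =>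
    isCompact_marginalSet (ν t i)
  have hmem (π : BehavioralStrategy Y U) : toLaw π ∈ K := fun t _ i _ => by
    have := π.markov t i
    exact Measure.fst_compProd (ν t i) (π.kernel t i)
  have hJ (π : BehavioralStrategy Y U) :
      D.J π = ∫⁻ p, staticCost D φ p.1 p.2
        ∂(Φ (toLaw π) : Measure (Omega0 X W0 × (∀ t i, Y t i × U t i))) :=
    hφ.J_eq hdyn hcost π
  obtain ⟨μ, hμ, hmin⟩ := (((lowerSemicontinuous_lintegral_probabilityMeasure
    (hφ.continuous_staticCost hdyn hcost)).comp hΦ).lowerSemicontinuousOn K).exists_isMinOn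
      ⟨_, hmem π₀⟩ hK
  -- Disintegration needs nonempty action spaces: `ν t i` provides a point `y`, and `π₀` a
  -- probability measure on `U t i` there.
  have hne (t : Fin T) (i : Fin N) : Nonempty (U t i) := by
    have := π₀.markov t i
    obtain ⟨y⟩ := (ν t i).nonempty_of_neZero
    exact (π₀.kernel t i y).nonempty_of_neZero
  let π : BehavioralStrategy Y U :=
    ⟨fun t i => (μ t i : Measure (Y t i × U t i)).condKernel, fun t i => inferInstance⟩
  -- Membership in `K` fixes the first marginal, so the conditional kernels of `μ` reproduce it.
  have hπ : toLaw π = μ := by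
    funext t i
    refine Subtype.ext ?_
    have h : (μ t i : Measure (Y t i × U t i)).fst = ν t i := hμ t trivial i trivial
    change ν t i ⊗ₘ (μ t i : Measure (Y t i × U t i)).condKernel = _
    rw [← h]
    exact Measure.disintegrate _ _
  refine ⟨π, fun π' => ?_⟩
  rw [hJ, hJ, hπ]
  exact hmin (hmem π')

end IsObsDensity

end DynamicTeam

end Team

end

theorem mainTheorem8 {N T : ℕ}
    {X : Fin (T + 1) → Type*} {Y U W : Fin T → Fin N → Type*} {W0 : Fin T → Type*}
    [∀ t, TopologicalSpace (X t)] [∀ t, PolishSpace (X t)]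
    [∀ t, MeasurableSpace (X t)] [∀ t, BorelSpace (X t)]
    [∀ t i, TopologicalSpace (Y t i)] [∀ t i, PolishSpace (Y t i)]
    [∀ t i, MeasurableSpace (Y t i)] [∀ t i, BorelSpace (Y t i)]
    [∀ t i, TopologicalSpace (U t i)] [∀ t i, PolishSpace (U t i)]
    [∀ t i, MeasurableSpace (U t i)] [∀ t i, BorelSpace (U t i)]
    [∀ t i, TopologicalSpace (W t i)] [∀ t i, PolishSpace (W t i)]
    [∀ t i, MeasurableSpace (W t i)] [∀ t i, BorelSpace (W t i)]
    [∀ t, TopologicalSpace (W0 t)] [∀ t, PolishSpace (W0 t)]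
    [∀ t, MeasurableSpace (W0 t)] [∀ t, BorelSpace (W0 t)]
    (D : Team.DynamicTeam N T X Y U W W0)
    (hU : ∀ t i, CompactSpace (U t i))
    (hdyn : D.ContinuousDynamics) (hcost : D.ContinuousCost)
    (hfin : D.FiniteCost) (habs : D.AbsContObservations) :
    ∃ γ : Team.DeterministicStrategy Y U, D.IsOptimal γ.toBehavioral := by
  obtain ⟨ν, φ, hφ⟩ := habs.exists_isObsDensity
  obtain ⟨π₀, -⟩ := hfin
  obtain ⟨π, hπ⟩ := hφ.exists_minimal_behavioral hU hdyn hcost π₀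
  obtain ⟨γ, hγ⟩ := hφ.exists_deterministic_le hU hdyn hcost π
  exact ⟨γ, le_antisymm (le_iInf fun π' => hγ.trans (hπ π')) (iInf_le _ _)⟩
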